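/- All graphs are finite, simple and undirected, with at least one vertex. For distinct vertices $u,v$ of a graph $G$ let $\lambda(u,v)$ be the maximum number of pairwise edge-disjoint $(u,v)$-paths in $G$, and let the edge-connectivity $\lambda(G)$ be the minimum of $\lambda(u,v)$ over all pairs of distinct vertices $u,v$ (with $\lambda(G)=\infty$ if $G$ has only one vertex). A graph is $k$-partite if its vertex set can be partitioned into $k$ (possibly empty) independent sets, and bipartite if it is $2$-partite. A 2T-graph is a graph whose edge set decomposes into the edge sets of two edge-disjoint spanning trees. Let $G$ be a graph. (a) If $\lambda(G)\ge 5$, then $G$ contains a spanning $3$-partite subgraph that is a 2T-graph. (b) If $\lambda(G)\ge 7$, then $G$ contains a spanning bipartite subgraph that is a 2T-graph. -/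

import Mathlib

namespace SimpleGraph

/-- `λ(u, v)`: the maximum number of pairwise edge-disjoint `(u, v)`-paths in `G`. It is used for
distinct `u`, `v` only, so that every path involved has an edge. -/
noncomputable def maxEdgeDisjointPaths {V : Type*} (G : SimpleGraph V) (u v : V) : ℕ∞ :=
  ⨆ (P : Set (G.Path u v))
    (_ : P.Pairwise fun p q => p.1.edges.Disjoint q.1.edges), P.encard

/-- The edge-connectivity `λ(G)`: the minimum of `λ(u, v)` over all pairs of distinct vertices.
(If `G` has only one vertex there is no such pair, and the value is `⊤`.) -/
noncomputable def edgeConnectivity {V : Type*} (G : SimpleGraph V) : ℕ∞ :=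
  ⨅ (u : V) (v : V) (_ : u ≠ v), G.maxEdgeDisjointPaths u v

/-- A 2T-graph: a graph whose edge set decomposes into (the edge sets of) two edge-disjoint
spanning trees. -/
def IsTwoTGraph {V : Type*} (H : SimpleGraph V) : Prop :=
  ∃ T₁ T₂ : SimpleGraph V, T₁.IsTree ∧ T₂.IsTree ∧
    Disjoint T₁.edgeSet T₂.edgeSet ∧ T₁.edgeSet ∪ T₂.edgeSet = H.edgeSet

end SimpleGraph

/-! Colour the vertices with `k + 1` colours so that as many edges as possible are bichromatic.
Shifting the colours on one side of a cut shows that at least `k / (k + 1)` of its edges are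
bichromatic. Two thirds of five and half of seven both exceed three, so every cut keeps at least
four edges (`exists_coloring_card_crossing_le`). Summing cuts over the classes of a partition gives
the Nash-Williams–Tutte condition for two trees (`partitionCondition_of_cuts`), and two disjoint
spanning trees of bichromatic edges follow.

The tree packing theorem (`PartitionCondition.hasTwoConnectors`) is proved by induction on
multigraphs. Delete a superfluous edge, or contract a proper vertex set that itself satisfies the
condition. If neither is possible, only trivial partitions are tight, so there are exactly `2 *
S.card - 2` edges and some vertex has degree two or three. Remove it, in the second case joining two
of its neighbours by a new edge.

Edges are abstract labels with end maps `a`, `b`, so that contraction and re-routing change only the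
maps and may create loops and parallel edges. -/

section TreePacking

variable {α E : Type*} [DecidableEq α] [DecidableEq E]

/-- The edges of the multigraph `(M, a, b)` whose two ends get different labels under `f`. -/
def crossing {β : Type*} [DecidableEq β] (M : Finset E) (a b : E → α) (f : α → β) : Finset E :=
  M.filter fun e => f (a e) ≠ f (b e)

/-- Every partition of `S` into `p` classes, given as the fibres of a labelling, is crossed by at
least `2 * (p - 1)` edges. -/
def PartitionCondition (S : Finset α) (M : Finset E) (a b : E → α) : Prop :=
  ∀ f : α → ℕ, 2 * (S.image f).card ≤ (crossing M a b f).card + 2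

/-- The edges in `F` connect all vertices in `S`. -/
def Connects (S : Finset α) (F : Finset E) (a b : E → α) : Prop :=
  ∀ T : Set α, (∀ e ∈ F, a e ∈ T ↔ b e ∈ T) → ∀ x ∈ S, ∀ y ∈ S, x ∈ T → y ∈ T

/-- The edge set `M` contains two disjoint sets each of which connects `S`. -/
def HasTwoConnectors (S : Finset α) (M : Finset E) (a b : E → α) : Prop :=
  ∃ F₁ F₂ : Finset E, F₁ ⊆ M ∧ F₂ ⊆ M ∧ Disjoint F₁ F₂ ∧ Connects S F₁ a b ∧ Connects S F₂ a b

/-- The edges of `M` with both ends in `X`. -/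
def inducedEdges (M : Finset E) (a b : E → α) (X : Finset α) : Finset E :=
  M.filter fun e => a e ∈ X ∧ b e ∈ X

/-- The edges of `M` with an end `v`. -/
def starEdges (M : Finset E) (a b : E → α) (v : α) : Finset E :=
  M.filter fun e => a e = v ∨ b e = v

/-! ### Contraction and tight partitions. -/

omit [DecidableEq α] [DecidableEq E] in
theorem HasTwoConnectors.mono {S : Finset α} {M N : Finset E} {a b : E → α}
    (h : HasTwoConnectors S M a b) (hMN : M ⊆ N) : HasTwoConnectors S N a b := by
  obtain ⟨F₁, F₂, h₁, h₂, h⟩ := h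
  exact ⟨F₁, F₂, h₁.trans hMN, h₂.trans hMN, h⟩

/-- A set `T` split by no edge of `F` contains all of `X` or none of it, so contracting `X` to `x₀`
does not affect membership in `T`. -/
theorem Connects.of_contraction {S X : Finset α} {F G : Finset E} {a b : E → α} {x₀ : α}
    (hX : x₀ ∈ X) (hF : Connects X F a b)
    (hG : Connects (S.image fun x => if x ∈ X then x₀ else x) G
      (fun e => if a e ∈ X then x₀ else a e) (fun e => if b e ∈ X then x₀ else b e)) :
    Connects S (F ∪ G) a b := by
  intro T hT
  have key : ∀ x, (if x ∈ X then x₀ else x) ∈ T ↔ x ∈ T := by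
    intro x
    split_ifs with hx
    · have := hF T fun e he => hT e (Finset.mem_union_left _ he)
      exact ⟨this _ hX _ hx, this _ hx _ hX⟩
    · rfl
  have h := hG T fun e he => by
    simp only [key]
    exact hT e (Finset.mem_union_right _ he)
  intro x hx y hy hxT
  exact (key y).1 (h _ (Finset.mem_image_of_mem _ hx) _ (Finset.mem_image_of_mem _ hy)
    ((key x).2 hxT))

/-- A labelling of the contraction pulls back to one that is constant on `X`, which no edge inside
`X` crosses. -/
theorem PartitionCondition.contraction {S X : Finset α} {M : Finset E} {a b : E → α} {x₀ : α}
    (h : PartitionCondition S M a b) :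
    PartitionCondition (S.image fun x => if x ∈ X then x₀ else x) (M \ inducedEdges M a b X)
      (fun e => if a e ∈ X then x₀ else a e) (fun e => if b e ∈ X then x₀ else b e) := by
  intro f
  have := h (f ∘ fun x => if x ∈ X then x₀ else x)
  rw [← Finset.image_image] at this
  refine this.trans (Nat.add_le_add_right (Finset.card_le_card ?_) 2)
  intro e he
  simp only [crossing, inducedEdges, Finset.mem_filter, Finset.mem_sdiff, Function.comp] at he ⊢
  refine ⟨⟨he.1, fun h' => he.2 ?_⟩, he.2⟩
  rw [if_pos h'.2.1, if_pos h'.2.2]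

/-- A class of a tight partition induces a multigraph satisfying the partition condition. -/
theorem PartitionCondition.induced_of_tight {S : Finset α} {M : Finset E} {a b : E → α}
    (h : PartitionCondition S M a b) (hS : ∀ e ∈ M, a e ∈ S ∧ b e ∈ S) {f : α → ℕ}
    (hf : (crossing M a b f).card + 2 ≤ 2 * (S.image f).card) {c : ℕ} (hc : c ∈ S.image f) :
    PartitionCondition (S.filter fun x => f x = c)
      (inducedEdges M a b (S.filter fun x => f x = c)) a b := by
  intro g
  set X := S.filter fun x => f x = c with hX
  -- Refine the tight partition by splitting its class `c` along `g`; parity keeps the new labels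
  -- apart from the old ones.
  have key := h fun x => if f x = c then 2 * g x else 2 * f x + 1
  have himage : (S.image fun x => if f x = c then 2 * g x else 2 * f x + 1) =
      (X.image g).image (fun n => 2 * n) ∪ ((S.image f).erase c).image fun n => 2 * n + 1 := by
    ext n
    simp only [hX, Finset.mem_image, Finset.mem_union, Finset.mem_filter, Finset.mem_erase]
    constructor
    · rintro ⟨x, hx, rfl⟩
      by_cases hxc : f x = c
      · exact Or.inl ⟨g x, ⟨x, ⟨hx, hxc⟩, rfl⟩, by simp [hxc]⟩
      · exact Or.inr ⟨f x, ⟨hxc, x, hx, rfl⟩, by simp [hxc]⟩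
    · rintro (⟨_, ⟨x, ⟨hx, hxc⟩, rfl⟩, rfl⟩ | ⟨_, ⟨hxc, x, hx, rfl⟩, rfl⟩)
      · exact ⟨x, hx, by simp [hxc]⟩
      · exact ⟨x, hx, by simp [hxc]⟩
  have hcard : (S.image fun x => if f x = c then 2 * g x else 2 * f x + 1).card =
      (X.image g).card + ((S.image f).card - 1) := by
    rw [himage, Finset.card_union_of_disjoint, Finset.card_image_of_injective (X.image g),
      Finset.card_image_of_injective ((S.image f).erase c), Finset.card_erase_of_mem hc]
    · intro m n hmn
      simpa using hmn
    · intro m n hmn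
      simpa using hmn
    · rw [Finset.disjoint_left]
      simp only [Finset.mem_image, not_exists, not_and]
      rintro _ ⟨m, -, rfl⟩ n - h'
      omega
  have hcross : (crossing M a b fun x => if f x = c then 2 * g x else 2 * f x + 1) ⊆
      crossing M a b f ∪ crossing (inducedEdges M a b X) a b g := by
    intro e he
    simp only [crossing, inducedEdges, hX, Finset.mem_filter, Finset.mem_union] at he ⊢
    have hab := hS e he.1
    by_cases h1 : f (a e) = f (b e)
    · by_cases h2 : f (b e) = c
      · refine Or.inr ⟨⟨he.1, ⟨hab.1, h1.trans h2⟩, hab.2, h2⟩, fun h3 => he.2 ?_⟩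
        simp [h1, h2, h3]
      · exact absurd (by simp [h1, h2]) he.2
    · exact Or.inl ⟨he.1, h1⟩
  have h1 := (Finset.card_le_card hcross).trans (Finset.card_union_le _ _)
  have h2 : 0 < (S.image f).card := Finset.card_pos.2 ⟨c, hc⟩
  omega

/-! ### Vertices of degree two and three. -/

/-- Some vertex of a nonempty set has degree at most the average. -/
theorem exists_card_star_le {S : Finset α} {M : Finset E} {a b : E → α}
    (hS : ∀ e ∈ M, a e ∈ S ∧ b e ∈ S) (hM : M.card + 2 ≤ 2 * S.card) :
    ∃ v ∈ S, (starEdges M a b v).card ≤ 3 := by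
  by_contra! hcon
  -- Otherwise the degree sum is at least `4 * S.card`, but it is at most `2 * M.card ≤ 4 * S.card -
  -- 4`.
  have h1 : S.card * 4 ≤ ∑ v ∈ S, (starEdges M a b v).card := by
    rw [← smul_eq_mul]
    exact Finset.card_nsmul_le_sum _ _ _ fun v hv => hcon v hv
  have h2 : ∑ v ∈ S, (starEdges M a b v).card ≤
      ∑ v ∈ S, ((M.filter fun e => a e = v).card + (M.filter fun e => b e = v).card) := by
    refine Finset.sum_le_sum fun v _ => ?_
    rw [starEdges, Finset.filter_or]
    exact Finset.card_union_le _ _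
  rw [Finset.sum_add_distrib, ← Finset.card_eq_sum_card_fiberwise fun e he => (hS e he).1,
    ← Finset.card_eq_sum_card_fiberwise fun e he => (hS e he).2] at h2
  omega

/-- The end of `e` other than `v`. -/
def otherEnd (a b : E → α) (v : α) (e : E) : α := if a e = v then b e else a e

omit [DecidableEq E] in
theorem otherEnd_mem_iff {M : Finset E} {a b : E → α} {v : α} {e : E} (he : e ∈ starEdges M a b v)
    {T : Set α} (hT : a e ∈ T ↔ b e ∈ T) : v ∈ T ↔ otherEnd a b v e ∈ T := by
  simp only [starEdges, Finset.mem_filter] at he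
  unfold otherEnd
  split_ifs with h
  · rw [← h]; exact hT
  · rw [← he.2.resolve_left h]; exact hT.symm

omit [DecidableEq E] in
theorem otherEnd_mem_erase {S : Finset α} {M : Finset E} {a b : E → α} {v : α} {e : E}
    (hS : ∀ e ∈ M, a e ∈ S ∧ b e ∈ S) (hloop : ∀ e ∈ M, a e ≠ b e) (he : e ∈ starEdges M a b v) :
    otherEnd a b v e ∈ S.erase v := by
  simp only [starEdges, Finset.mem_filter] at he
  have := hS e he.1
  have := hloop e he.1
  unfold otherEnd
  split_ifs with h
  · rw [Finset.mem_erase]; grind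
  · rw [Finset.mem_erase]; grind

omit [DecidableEq E] in
theorem Connects.of_erase {S : Finset α} {F : Finset E} {a b : E → α} {v x : α}
    (hx : x ∈ S.erase v) (h : ∀ T : Set α, (∀ e ∈ F, a e ∈ T ↔ b e ∈ T) →
      (v ∈ T ↔ x ∈ T) ∧ ∀ y ∈ S.erase v, ∀ z ∈ S.erase v, y ∈ T → z ∈ T) :
    Connects S F a b := by
  intro T hT y hy z hz hyT
  obtain ⟨h1, h2⟩ := h T hT
  have key : ∀ w ∈ S, w ∈ T ↔ x ∈ T := by
    intro w hw
    by_cases hwv : w = v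
    · rw [hwv]; exact h1
    · have hw' := Finset.mem_erase.2 ⟨hwv, hw⟩
      exact ⟨h2 _ hw' _ hx, h2 _ hx _ hw'⟩
  rw [key z hz, ← key y hy]
  exact hyT

theorem card_image_isolate {S : Finset α} {v : α} (hv : v ∈ S) (f : α → ℕ) :
    (S.image fun x => if x = v then 0 else f x + 1).card = ((S.erase v).image f).card + 1 := by
  have : (S.image fun x => if x = v then 0 else f x + 1) =
      insert 0 (((S.erase v).image f).image (· + 1)) := by
    ext n
    simp only [Finset.mem_image, Finset.mem_insert, Finset.mem_erase]
    constructor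
    · rintro ⟨x, hx, rfl⟩
      by_cases hxv : x = v
      · simp [hxv]
      · exact Or.inr ⟨f x, ⟨x, ⟨hxv, hx⟩, rfl⟩, by simp [hxv]⟩
    · rintro (rfl | ⟨_, ⟨x, ⟨hxv, hx⟩, rfl⟩, rfl⟩)
      · exact ⟨v, hv, by simp⟩
      · exact ⟨x, hx, by simp [hxv]⟩
  rw [this, Finset.card_insert_of_notMem, Finset.card_image_of_injective]
  · exact add_left_injective 1
  · simp

theorem crossing_isolate_subset (M : Finset E) (a b : E → α) (v : α) (f : α → ℕ) :
    (crossing M a b fun x => if x = v then 0 else f x + 1) ⊆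
      starEdges M a b v ∪ crossing (M \ starEdges M a b v) a b f := by
  intro e he
  simp only [crossing, starEdges, Finset.mem_filter, Finset.mem_union, Finset.mem_sdiff] at he ⊢
  grind

/-- Adding `{v}` as a class of its own costs at most two crossing edges, exactly what one more class
demands. -/
theorem PartitionCondition.erase {S : Finset α} {M : Finset E} {a b : E → α} {v : α}
    (h : PartitionCondition S M a b) (hv : v ∈ S) (hdeg : (starEdges M a b v).card ≤ 2) :
    PartitionCondition (S.erase v) (M \ starEdges M a b v) a b := by
  intro f
  have h1 := h fun x => if x = v then 0 else f x + 1
  rw [card_image_isolate hv] at h1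
  have h2 := (Finset.card_le_card (crossing_isolate_subset M a b v f)).trans
    (Finset.card_union_le _ _)
  omega

theorem ends_mem_erase {S : Finset α} {M : Finset E} {a b : E → α}
    (hS : ∀ e ∈ M, a e ∈ S ∧ b e ∈ S) (v : α) :
    ∀ e ∈ M \ starEdges M a b v, a e ∈ S.erase v ∧ b e ∈ S.erase v := by
  intro e he
  simp only [starEdges, Finset.mem_filter, Finset.mem_sdiff, Finset.mem_erase] at he ⊢
  have := hS e he.1
  grind

/-- Two disjoint connecting sets extend to a new vertex with two edges. -/
theorem HasTwoConnectors.of_erase {S : Finset α} {M : Finset E} {a b : E → α} {v : α}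
    (hS : ∀ e ∈ M, a e ∈ S ∧ b e ∈ S) (hloop : ∀ e ∈ M, a e ≠ b e)
    (hdeg : 2 ≤ (starEdges M a b v).card)
    (h : HasTwoConnectors (S.erase v) (M \ starEdges M a b v) a b) : HasTwoConnectors S M a b := by
  obtain ⟨F₁, F₂, h₁, h₂, hd, hc₁, hc₂⟩ := h
  obtain ⟨e₁, he₁, e₂, he₂, hne⟩ := Finset.one_lt_card.1 hdeg
  have hsub : starEdges M a b v ⊆ M := Finset.filter_subset _ _
  have aux : ∀ e ∈ starEdges M a b v, ∀ F, Connects (S.erase v) F a b →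
      Connects S (insert e F) a b := by
    intro e he F hF
    refine Connects.of_erase (otherEnd_mem_erase hS hloop he) fun T hT => ?_
    exact ⟨otherEnd_mem_iff he (hT e (Finset.mem_insert_self _ _)),
      hF T fun e' he' => hT e' (Finset.mem_insert_of_mem he')⟩
  refine ⟨insert e₁ F₁, insert e₂ F₂, ?_, ?_, ?_, aux _ he₁ _ hc₁, aux _ he₂ _ hc₂⟩
  · exact Finset.insert_subset (hsub he₁) (h₁.trans Finset.sdiff_subset)
  · exact Finset.insert_subset (hsub he₂) (h₂.trans Finset.sdiff_subset)
  · have n₁ : e₁ ∉ F₂ := fun h' => (Finset.mem_sdiff.1 (h₂ h')).2 he₁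
    have n₂ : e₂ ∉ F₁ := fun h' => (Finset.mem_sdiff.1 (h₁ h')).2 he₂
    simp [Finset.disjoint_insert_left, Finset.disjoint_insert_right, hne.symm, n₁, n₂, hd]

/-- Undoing the removal of a vertex `v` of degree three, where the edge `e₁` was re-routed to join
the other ends of the edges `e₁` and `e₂` at `v`. -/
theorem HasTwoConnectors.of_reroute {S : Finset α} {M : Finset E} {a b : E → α} {v : α}
    {e₁ e₂ e₃ : E}
    (hS : ∀ e ∈ M, a e ∈ S ∧ b e ∈ S) (hloop : ∀ e ∈ M, a e ≠ b e)
    (hstar : starEdges M a b v = {e₁, e₂, e₃}) (h12 : e₁ ≠ e₂) (h13 : e₁ ≠ e₃) (h23 : e₂ ≠ e₃)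
    (h : HasTwoConnectors (S.erase v) (M \ {e₂, e₃})
      (Function.update a e₁ (otherEnd a b v e₁)) (Function.update b e₁ (otherEnd a b v e₂))) :
    HasTwoConnectors S M a b := by
  have he₁ : e₁ ∈ starEdges M a b v := by simp [hstar]
  have he₂ : e₂ ∈ starEdges M a b v := by simp [hstar]
  have he₃ : e₃ ∈ starEdges M a b v := by simp [hstar]
  have hsub : starEdges M a b v ⊆ M := Finset.filter_subset _ _
  -- The set that may use the re-routed edge gets the path `e₁`, `e₂` through `v` instead; the other
  -- set reaches `v` by `e₃`.
  have aux : ∀ F₁ F₂ : Finset E, F₁ ⊆ M \ {e₂, e₃} → F₂ ⊆ M \ {e₂, e₃} → Disjoint F₁ F₂ →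
      e₁ ∉ F₂ →
      Connects (S.erase v) F₁ (Function.update a e₁ (otherEnd a b v e₁))
        (Function.update b e₁ (otherEnd a b v e₂)) →
      Connects (S.erase v) F₂ (Function.update a e₁ (otherEnd a b v e₁))
        (Function.update b e₁ (otherEnd a b v e₂)) → HasTwoConnectors S M a b := by
    intro F₁ F₂ h₁ h₂ hd hn hc₁ hc₂
    refine ⟨insert e₁ (insert e₂ F₁), insert e₃ F₂, ?_, ?_, ?_, ?_, ?_⟩
    · exact Finset.insert_subset (hsub he₁)
        (Finset.insert_subset (hsub he₂) (h₁.trans Finset.sdiff_subset))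
    · exact Finset.insert_subset (hsub he₃) (h₂.trans Finset.sdiff_subset)
    · have n₂ : e₂ ∉ F₂ := fun h' => (Finset.mem_sdiff.1 (h₂ h')).2 (by simp)
      have n₃ : e₃ ∉ F₁ := fun h' => (Finset.mem_sdiff.1 (h₁ h')).2 (by simp)
      rw [Finset.disjoint_left] at hd ⊢
      grind
    · refine Connects.of_erase (otherEnd_mem_erase hS hloop he₁) fun T hT => ?_
      have t₁ := otherEnd_mem_iff he₁ (hT e₁ (by simp))
      have t₂ := otherEnd_mem_iff he₂ (hT e₂ (by simp))
      refine ⟨t₁, hc₁ T fun e he => ?_⟩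
      by_cases hee : e = e₁
      · subst hee
        simp only [Function.update_self]
        rw [← t₁, ← t₂]
      · simp only [Function.update_of_ne hee]
        exact hT e (by simp [he])
    · refine Connects.of_erase (otherEnd_mem_erase hS hloop he₃) fun T hT => ?_
      refine ⟨otherEnd_mem_iff he₃ (hT e₃ (by simp)), hc₂ T fun e he => ?_⟩
      have hee : e ≠ e₁ := fun h' => hn (h' ▸ he)
      simp only [Function.update_of_ne hee]
      exact hT e (by simp [he])
  obtain ⟨F₁, F₂, h₁, h₂, hd, hc₁, hc₂⟩ := h
  by_cases hn : e₁ ∈ F₂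
  · exact aux F₂ F₁ h₂ h₁ hd.symm (Finset.disjoint_right.1 hd hn) hc₂ hc₁
  · exact aux F₁ F₂ h₁ h₂ hd hn hc₁ hc₂

omit [DecidableEq α] [DecidableEq E] in
theorem crossing_eq_self {S : Finset α} {M : Finset E} {a b : E → α}
    (hS : ∀ e ∈ M, a e ∈ S ∧ b e ∈ S) (hloop : ∀ e ∈ M, a e ≠ b e) {f : α → ℕ}
    (hf : Set.InjOn f S) : crossing M a b f = M :=
  Finset.filter_true_of_mem fun e he h => hloop e he (hf (hS e he).1 (hS e he).2 h)

/-- Removing a vertex of degree three and re-routing one of its edges preserves the partition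
condition, if only the trivial partitions can be tight. -/
theorem PartitionCondition.reroute {S : Finset α} {M : Finset E} {a b : E → α} {v : α}
    {e₁ e₂ e₃ : E} (hS : ∀ e ∈ M, a e ∈ S ∧ b e ∈ S) (hloop : ∀ e ∈ M, a e ≠ b e)
    (hcard : 2 * S.card ≤ M.card + 2)
    (htight : ∀ f : α → ℕ, (crossing M a b f).card + 2 ≤ 2 * (S.image f).card →
      1 < (S.image f).card → (S.image f).card = S.card)
    (hstar : starEdges M a b v = {e₁, e₂, e₃}) (hv : v ∈ S) (h12 : e₁ ≠ e₂) (h13 : e₁ ≠ e₃)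
    (h23 : e₂ ≠ e₃) (hne : otherEnd a b v e₁ ≠ otherEnd a b v e₂) :
    PartitionCondition (S.erase v) (M \ {e₂, e₃})
      (Function.update a e₁ (otherEnd a b v e₁)) (Function.update b e₁ (otherEnd a b v e₂)) := by
  have he₁ : e₁ ∈ starEdges M a b v := by simp [hstar]
  have he₂ : e₂ ∈ starEdges M a b v := by simp [hstar]
  have he₃ : e₃ ∈ starEdges M a b v := by simp [hstar]
  have hsub : starEdges M a b v ⊆ M := Finset.filter_subset _ _
  have hcs : (starEdges M a b v).card = 3 := by
    rw [hstar]; exact Finset.card_eq_three.2 ⟨_, _, _, h12, h13, h23, rfl⟩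
  have hS' := ends_mem_erase hS v
  have hsplit : ∀ e ∈ M \ {e₂, e₃}, e ≠ e₁ → e ∈ M \ starEdges M a b v := by
    intro e he hee
    rw [hstar]
    simp only [Finset.mem_sdiff, Finset.mem_insert, Finset.mem_singleton] at he ⊢
    tauto
  have hSe := Finset.card_erase_of_mem hv
  have hpos : 0 < S.card := Finset.card_pos.2 ⟨v, hv⟩
  intro f
  -- The discrete partition is settled by counting: one vertex and two edges are lost. For any
  -- other, isolating `v` gives a partition that is not tight, and this spare edge makes up for the
  -- third edge at `v`.
  by_cases hf : Set.InjOn f (S.erase v : Finset α)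
  · rw [crossing_eq_self (S := S.erase v) _ _ hf, Finset.card_image_of_injOn hf,
      Finset.card_sdiff_of_subset, Finset.card_pair h23]
    · omega
    · intro e he
      simp only [Finset.mem_insert, Finset.mem_singleton] at he
      rcases he with rfl | rfl
      exacts [hsub he₂, hsub he₃]
    · intro e he
      by_cases hee : e = e₁
      · subst hee
        simp only [Function.update_self]
        exact ⟨otherEnd_mem_erase hS hloop he₁, otherEnd_mem_erase hS hloop he₂⟩
      · simp only [Function.update_of_ne hee]
        exact hS' e (hsplit e he hee)
    · intro e he
      by_cases hee : e = e₁
      · subst hee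
        simpa only [Function.update_self] using hne
      · simp only [Function.update_of_ne hee]
        exact hloop e (Finset.mem_sdiff.1 he).1
  · have hlt : ((S.erase v).image f).card < (S.erase v).card :=
      lt_of_le_of_ne Finset.card_image_le fun h' => hf (Finset.card_image_iff.1 h')
    have himg : 0 < ((S.erase v).image f).card :=
      Finset.card_pos.2 ⟨_, Finset.mem_image_of_mem f (otherEnd_mem_erase hS hloop he₁)⟩
    have h1 := htight fun x => if x = v then 0 else f x + 1
    rw [card_image_isolate hv] at h1
    have h2 := (Finset.card_le_card (crossing_isolate_subset M a b v f)).trans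
      (Finset.card_union_le _ _)
    have h3 : crossing (M \ starEdges M a b v) a b f ⊆ crossing (M \ {e₂, e₃})
        (Function.update a e₁ (otherEnd a b v e₁))
        (Function.update b e₁ (otherEnd a b v e₂)) f := by
      intro e he
      simp only [crossing, Finset.mem_filter] at he ⊢
      have hee : e ≠ e₁ := by
        rintro rfl
        exact (Finset.mem_sdiff.1 he.1).2 he₁
      simp only [Function.update_of_ne hee]
      refine ⟨?_, he.2⟩
      rw [hstar] at he
      simp only [Finset.mem_sdiff, Finset.mem_insert, Finset.mem_singleton] at he ⊢
      tauto
    have h4 := Finset.card_le_card h3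
    omega

/-- The edges at a vertex of degree three do not all have the same other end. -/
theorem PartitionCondition.exists_otherEnd_ne [Countable α] {S : Finset α} {M : Finset E}
    {a b : E → α} {v : α} (h : PartitionCondition S M a b)
    (hS : ∀ e ∈ M, a e ∈ S ∧ b e ∈ S) (hloop : ∀ e ∈ M, a e ≠ b e)
    (hcard : M.card + 2 ≤ 2 * S.card) (hv : v ∈ S) (hdeg : (starEdges M a b v).card = 3) :
    ∃ e₁ ∈ starEdges M a b v, ∃ e₂ ∈ starEdges M a b v, otherEnd a b v e₁ ≠ otherEnd a b v e₂ := by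
  by_contra! hcon
  obtain ⟨ι, hι⟩ := exists_injective_nat α
  obtain ⟨e₀, he₀⟩ : (starEdges M a b v).Nonempty := Finset.card_pos.1 (by omega)
  set x := otherEnd a b v e₀ with hx
  have hxS : x ∈ S.erase v := otherEnd_mem_erase hS hloop he₀
  -- Merging `v` with its only neighbour `x` loses one class but three crossing edges, contradicting
  -- the edge count.
  have key := h fun y => if y = v then ι x else ι y
  have himg : (S.erase v).card ≤ (S.image fun y => if y = v then ι x else ι y).card := by
    rw [← Finset.card_image_of_injective (S.erase v) hι]
    refine Finset.card_le_card fun n hn => ?_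
    simp only [Finset.mem_image, Finset.mem_erase] at hn ⊢
    obtain ⟨y, ⟨hyv, hy⟩, rfl⟩ := hn
    exact ⟨y, hy, by simp [hyv]⟩
  have hcross : (crossing M a b fun y => if y = v then ι x else ι y) ⊆ M \ starEdges M a b v := by
    intro e he
    simp only [crossing, Finset.mem_filter] at he
    refine Finset.mem_sdiff.2 ⟨he.1, fun hes => he.2 ?_⟩
    have h1 := hcon e hes e₀ he₀
    rw [← hx] at h1
    simp only [starEdges, Finset.mem_filter] at hes
    unfold otherEnd at h1
    grind
  have h1 := Finset.card_le_card hcross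
  have hsub : starEdges M a b v ⊆ M := Finset.filter_subset _ _
  rw [Finset.card_sdiff_of_subset hsub, hdeg] at h1
  have h2 : (starEdges M a b v).card ≤ M.card := Finset.card_le_card (Finset.filter_subset _ _)
  have hSe := Finset.card_erase_of_mem hv
  have hpos : 0 < S.card := Finset.card_pos.2 ⟨v, hv⟩
  omega

/-- The partition condition bounds every degree below by two. -/
theorem PartitionCondition.two_le_card_star {S : Finset α} {M : Finset E} {a b : E → α} {v : α}
    (h : PartitionCondition S M a b) (hv : v ∈ S) (hS : 1 < S.card) :
    2 ≤ (starEdges M a b v).card := by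
  obtain ⟨w, hw, hwv⟩ := Finset.exists_mem_ne hS v
  have h1 := h fun x => if x = v then 0 else 0 + 1
  rw [card_image_isolate hv fun _ => 0] at h1
  have h2 := Finset.card_le_card (crossing_isolate_subset M a b v fun _ => 0)
  have h3 : 0 < ((S.erase v).image fun _ => 0).card :=
    Finset.card_pos.2 ⟨0, Finset.mem_image.2 ⟨w, Finset.mem_erase.2 ⟨hwv, hw⟩, rfl⟩⟩
  have h4 : crossing (M \ starEdges M a b v) a b (fun _ => 0) = ∅ := by simp [crossing]
  rw [h4, Finset.union_empty] at h2
  omega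

/-! ### The tree packing induction. -/

/-- Connectors of `X` and of the contraction of `X` use disjoint edge sets, so they can be united in
pairs. -/
theorem PartitionCondition.hasTwoConnectors_of_induced {S : Finset α} {M : Finset E}
    {a b : E → α} {X : Finset α} (h : PartitionCondition S M a b)
    (hS : ∀ e ∈ M, a e ∈ S ∧ b e ∈ S)
    (hX : X ⊆ S) (hcard : 1 < X.card)
    (hconn : HasTwoConnectors X (inducedEdges M a b X) a b)
    (ih : ∀ (S' : Finset α) (M' : Finset E) (a' b' : E → α), S'.card < S.card → M' ⊆ M →
      (∀ e ∈ M', a' e ∈ S' ∧ b' e ∈ S') → PartitionCondition S' M' a' b' →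
      HasTwoConnectors S' M' a' b') : HasTwoConnectors S M a b := by
  obtain ⟨x₀, hx₀⟩ : X.Nonempty := Finset.card_pos.1 (by omega)
  obtain ⟨F₁, F₂, h₁, h₂, hd, hc₁, hc₂⟩ := hconn
  obtain ⟨x₁, hx₁, hne⟩ := Finset.exists_mem_ne hcard x₀
  have hlt : (S.image fun x => if x ∈ X then x₀ else x).card < S.card := by
    refine (Finset.card_le_card (t := S.erase x₁) fun y hy => ?_).trans_lt
      (Finset.card_erase_lt_of_mem (hX hx₁))
    obtain ⟨x, hx, rfl⟩ := Finset.mem_image.1 hy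
    have := hX hx₀
    rw [Finset.mem_erase]
    grind
  obtain ⟨G₁, G₂, g₁, g₂, gd, gc₁, gc₂⟩ := ih _ _ _ _ hlt Finset.sdiff_subset (fun e he =>
    have := hS e (Finset.mem_sdiff.1 he).1
    ⟨Finset.mem_image_of_mem _ this.1, Finset.mem_image_of_mem _ this.2⟩)
    (h.contraction (X := X) (x₀ := x₀))
  have hIM : inducedEdges M a b X ⊆ M := Finset.filter_subset _ _
  refine ⟨F₁ ∪ G₁, F₂ ∪ G₂, ?_, ?_, ?_, hc₁.of_contraction hx₀ gc₁,
    hc₂.of_contraction hx₀ gc₂⟩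
  · exact Finset.union_subset (h₁.trans hIM) (g₁.trans Finset.sdiff_subset)
  · exact Finset.union_subset (h₂.trans hIM) (g₂.trans Finset.sdiff_subset)
  · rw [Finset.disjoint_union_left, Finset.disjoint_union_right, Finset.disjoint_union_right]
    exact ⟨⟨hd, Finset.disjoint_of_subset_left h₁
        (Finset.disjoint_of_subset_right g₂ Finset.disjoint_sdiff)⟩,
      Finset.disjoint_of_subset_left g₁
        (Finset.disjoint_of_subset_right h₂ Finset.sdiff_disjoint), gd⟩

/-- The tree packing theorem of Nash-Williams and Tutte for two trees. -/
theorem PartitionCondition.hasTwoConnectors [Countable α] {S : Finset α} {M : Finset E}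
    {a b : E → α} (h : PartitionCondition S M a b) (hS : ∀ e ∈ M, a e ∈ S ∧ b e ∈ S) :
    HasTwoConnectors S M a b := by
  induction hn : S.card + M.card using Nat.strong_induction_on generalizing S M a b with
  | _ n ih =>
  subst hn
  by_cases hS1 : S.card ≤ 1
  · have hc : Connects S ∅ a b := fun T _ x hx y hy hxT =>
      Finset.card_le_one.1 hS1 x hx y hy ▸ hxT
    exact ⟨∅, ∅, by simp, by simp, by simp, hc, hc⟩
  by_cases hdel : ∃ e ∈ M, PartitionCondition S (M.erase e) a b
  · obtain ⟨e, he, h'⟩ := hdel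
    have := Finset.card_erase_lt_of_mem he
    exact (ih _ (by omega) h' (fun e he => hS e (Finset.mem_of_mem_erase he)) rfl).mono
      (Finset.erase_subset _ _)
  by_cases hind : ∃ X ⊆ S, 1 < X.card ∧ X.card < S.card ∧
      PartitionCondition X (inducedEdges M a b X) a b
  · obtain ⟨X, hX, hX1, hXS, h'⟩ := hind
    have hIM : (inducedEdges M a b X).card ≤ M.card :=
      Finset.card_le_card (Finset.filter_subset _ _)
    refine h.hasTwoConnectors_of_induced hS hX hX1
      (ih _ (by omega) h' (fun e he => (Finset.mem_filter.1 he).2) rfl) ?_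
    intro S' M' a' b' hlt hM' hS' h'
    have := Finset.card_le_card hM'
    exact ih _ (by omega) h' hS' rfl
  -- A class with two or more vertices of a tight partition into several classes would be a set `X`
  -- excluded by `hind`.
  have htight : ∀ f : α → ℕ, (crossing M a b f).card + 2 ≤ 2 * (S.image f).card →
      1 < (S.image f).card → (S.image f).card = S.card := by
    intro f hf h1
    by_contra hne
    have hlt := lt_of_le_of_ne Finset.card_image_le hne
    obtain ⟨x, hx, y, hy, hxy, hfxy⟩ := Finset.exists_ne_map_eq_of_card_lt_of_maps_to hlt
      fun x hx => Finset.mem_image_of_mem f hx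
    refine hind ⟨S.filter fun z => f z = f x, Finset.filter_subset _ _, ?_, ?_,
      h.induced_of_tight hS hf (Finset.mem_image_of_mem f hx)⟩
    · exact Finset.one_lt_card.2 ⟨x, by simp [hx], y, by simp [hy, hfxy], hxy⟩
    · obtain ⟨c, hc, hcx⟩ := Finset.exists_mem_ne h1 (f x)
      obtain ⟨z, hz, rfl⟩ := Finset.mem_image.1 hc
      exact Finset.card_lt_card (Finset.filter_ssubset.2 ⟨z, hz, hcx⟩)
  -- An edge that cannot be deleted crosses a tight partition, which is discrete by `htight`. Hence
  -- there are no loops, and `M.card + 2 = 2 * S.card`.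
  have hdisc : ∀ e ∈ M, ∃ f : α → ℕ, Set.InjOn f S ∧ f (a e) ≠ f (b e) ∧
      (crossing M a b f).card + 2 ≤ 2 * S.card := by
    intro e he
    have h1 : ¬ PartitionCondition S (M.erase e) a b := fun h' => hdel ⟨e, he, h'⟩
    unfold PartitionCondition at h1
    push Not at h1
    obtain ⟨f, hf⟩ := h1
    have h2 := h f
    have h3 : crossing (M.erase e) a b f = (crossing M a b f).erase e := by
      ext e'
      simp [crossing, and_assoc]
    rw [h3] at hf
    have hef : e ∈ crossing M a b f := by
      by_contra hef
      rw [Finset.erase_eq_of_notMem hef] at hf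
      omega
    rw [Finset.card_erase_of_mem hef] at hf
    have hpos : 0 < (crossing M a b f).card := Finset.card_pos.2 ⟨e, hef⟩
    have hne := (Finset.mem_filter.1 hef).2
    have h4 : 1 < (S.image f).card := Finset.one_lt_card.2
      ⟨_, Finset.mem_image_of_mem f (hS e he).1, _, Finset.mem_image_of_mem f (hS e he).2, hne⟩
    have h5 := htight f (by omega) h4
    exact ⟨f, Finset.card_image_iff.1 h5, hne, by omega⟩
  have hloop : ∀ e ∈ M, a e ≠ b e := by
    intro e he hab
    obtain ⟨f, -, hf, -⟩ := hdisc e he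
    exact hf (by rw [hab])
  have hMcard : 2 * S.card ≤ M.card + 2 := by
    obtain ⟨ι, hι⟩ := exists_injective_nat α
    have := h ι
    rwa [Finset.card_image_of_injective _ hι, crossing_eq_self hS hloop hι.injOn] at this
  obtain ⟨e₀, he₀⟩ : M.Nonempty := Finset.card_pos.1 (by omega)
  have hMcard' : M.card + 2 ≤ 2 * S.card := by
    obtain ⟨f, hf, -, hf'⟩ := hdisc e₀ he₀
    rwa [crossing_eq_self hS hloop hf] at hf'
  obtain ⟨v, hv, hdeg⟩ := exists_card_star_le hS hMcard'
  have hdeg' := h.two_le_card_star hv (by omega)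
  have hSe := Finset.card_erase_lt_of_mem hv
  by_cases hdeg2 : (starEdges M a b v).card ≤ 2
  · have := Finset.card_le_card (Finset.sdiff_subset (s := M) (t := starEdges M a b v))
    exact HasTwoConnectors.of_erase hS hloop hdeg'
      (ih _ (by omega) (h.erase hv hdeg2) (ends_mem_erase hS v) rfl)
  · have hdeg3 : (starEdges M a b v).card = 3 := by omega
    obtain ⟨e₁, he₁, e₂, he₂, hne⟩ := h.exists_otherEnd_ne hS hloop hMcard' hv hdeg3
    have h12 : e₁ ≠ e₂ := fun h' => hne (h' ▸ rfl)
    obtain ⟨e₃, he₃⟩ : (((starEdges M a b v).erase e₁).erase e₂).Nonempty := by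
      rw [← Finset.card_pos, Finset.card_erase_of_mem (by simp [he₂, h12.symm]),
        Finset.card_erase_of_mem he₁]
      omega
    simp only [Finset.mem_erase] at he₃
    have hstar : starEdges M a b v = {e₁, e₂, e₃} := by
      symm
      apply Finset.eq_of_subset_of_card_le
      · intro e he
        simp only [Finset.mem_insert, Finset.mem_singleton] at he
        rcases he with rfl | rfl | rfl
        exacts [he₁, he₂, he₃.2.2]
      · rw [hdeg3, Finset.card_eq_three.2 ⟨e₁, e₂, e₃, h12, he₃.2.1.symm, he₃.1.symm, rfl⟩]
    have := Finset.card_le_card (Finset.sdiff_subset (s := M) (t := {e₂, e₃}))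
    refine HasTwoConnectors.of_reroute hS hloop hstar h12 he₃.2.1.symm he₃.1.symm
      (ih _ (by omega) (PartitionCondition.reroute hS hloop hMcard htight hstar hv h12 he₃.2.1.symm
        he₃.1.symm hne)
        (fun e he => ?_) rfl)
    by_cases hee : e = e₁
    · subst hee
      simp only [Function.update_self]
      exact ⟨otherEnd_mem_erase hS hloop he₁, otherEnd_mem_erase hS hloop he₂⟩
    · simp only [Function.update_of_ne hee]
      refine ends_mem_erase hS v e ?_
      rw [hstar]
      simp only [Finset.mem_sdiff, Finset.mem_insert, Finset.mem_singleton] at he ⊢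
      tauto

end TreePacking

/-! ### Colourings with the most bichromatic edges. -/

section MaximumColoring

variable {α E : Type*} [DecidableEq E]

/-- In a colouring with `k + 1` colours that maximizes the number of crossing edges, every cut
has at least the fraction `k / (k + 1)` of its edges crossing. -/
theorem exists_coloring_card_crossing_le [Finite α] (M : Finset E) (a b : E → α) (k : ℕ) :
    ∃ c : α → ZMod (k + 1), ∀ X : Set α, ∀ [DecidablePred (· ∈ X)],
      k * (crossing M a b (· ∈ X)).card ≤
        (k + 1) * (crossing (crossing M a b c) a b (· ∈ X)).card := by
  have : Fintype (ZMod (k + 1)) := ZMod.fintype (k + 1)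
  obtain ⟨c, hc⟩ := Finite.exists_max fun c : α → ZMod (k + 1) => (crossing M a b c).card
  refine ⟨c, fun X _ => ?_⟩
  set D := crossing M a b (· ∈ X) with hD
  -- The cut edges that become monochromatic when `j` is added to all colours in `X`. Edges outside
  -- the cut keep their status, so maximality of `c` makes `mono 0` the smallest of these sets.
  set mono : ZMod (k + 1) → Finset E := fun j => D.filter fun e =>
    c (a e) + (if a e ∈ X then j else 0) = c (b e) + (if b e ∈ X then j else 0) with hmono
  have hle : ∀ j, (mono 0).card ≤ (mono j).card := by
    intro j
    have h1 : _ ≤ (crossing M a b fun x => c x).card := hc fun x => c x + if x ∈ X then j else 0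
    have split : ∀ j, (crossing M a b fun x => c x + if x ∈ X then j else 0).card + (mono j).card =
        ((M \ D).filter fun e => c (a e) ≠ c (b e)).card + D.card := by
      intro j
      have e1 : (crossing M a b fun x => c x + if x ∈ X then j else 0) =
          ((M \ D).filter fun e => c (a e) ≠ c (b e)) ∪ (D \ mono j) := by
        ext e
        simp only [crossing, hD, hmono, Finset.mem_filter, Finset.mem_union, Finset.mem_sdiff]
        by_cases h1 : a e ∈ X <;> by_cases h2 : b e ∈ X <;> simp [h1, h2] <;> tauto
      have hsub : mono j ⊆ D := Finset.filter_subset _ _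
      rw [e1, Finset.card_union_of_disjoint, Finset.card_sdiff_of_subset hsub]
      · have := Finset.card_le_card hsub
        omega
      · refine Finset.disjoint_of_subset_left (Finset.filter_subset _ _) ?_
        exact Finset.disjoint_of_subset_right Finset.sdiff_subset Finset.sdiff_disjoint
    have h2 := split j
    have h3 := split 0
    simp only [ite_self, add_zero] at h3
    omega
  -- Each cut edge becomes monochromatic for exactly one shift, the colour difference of its ends.
  have hsum : ∑ j, (mono j).card = D.card := by
    have hfib : ∀ j, mono j = D.filter fun e =>
        (if a e ∈ X then c (b e) - c (a e) else c (a e) - c (b e)) = j := by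
      intro j
      refine Finset.filter_congr fun e he => ?_
      simp only [hD, crossing, Finset.mem_filter] at he
      have := he.2
      by_cases h1 : a e ∈ X <;> by_cases h2 : b e ∈ X <;> simp [h1, h2] at this ⊢
      · rw [sub_eq_iff_eq_add, add_comm j, eq_comm]
      · rw [sub_eq_iff_eq_add, add_comm j]
    simp only [hfib]
    exact (Finset.card_eq_sum_card_fiberwise fun e _ => Finset.mem_coe.2 (Finset.mem_univ _)).symm
  have h1 : (k + 1) * (mono 0).card ≤ D.card := by
    rw [← hsum]
    have := Finset.card_nsmul_le_sum Finset.univ (fun j => (mono j).card) _ fun j _ => hle j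
    simpa [ZMod.card] using this
  have h2 : crossing (crossing M a b c) a b (· ∈ X) = D \ mono 0 := by
    ext e
    simp only [crossing, hD, hmono, Finset.mem_filter, Finset.mem_sdiff, ite_self, add_zero]
    tauto
  have hsub : mono 0 ⊆ D := Finset.filter_subset _ _
  have h3 := Finset.card_sdiff_add_card_eq_card hsub
  rw [h2, ← h3]
  rw [← h3] at h1
  linarith

/-- If all cuts have at least four edges, the partition condition holds. -/
theorem partitionCondition_of_cuts {S : Finset α} {M : Finset E} {a b : E → α}
    (hS : ∀ e ∈ M, a e ∈ S ∧ b e ∈ S)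
    (h : ∀ X : Set α, ∀ [DecidablePred (· ∈ X)], (∃ x ∈ S, x ∈ X) → (∃ x ∈ S, x ∉ X) →
      4 ≤ (crossing M a b (· ∈ X)).card) : PartitionCondition S M a b := by
  intro f
  by_cases h1 : (S.image f).card ≤ 1
  · omega
  -- Each crossing edge lies in the cuts of just two classes, so `p > 1` classes are crossed by at
  -- least `2 * p` edges.
  have h2 : (S.image f).card * 4 ≤
      ∑ c ∈ S.image f, (crossing M a b (· ∈ {x | f x = c})).card := by
    rw [← smul_eq_mul]
    refine Finset.card_nsmul_le_sum _ _ _ fun c hc => ?_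
    obtain ⟨x, hx, rfl⟩ := Finset.mem_image.1 hc
    obtain ⟨d, hd, hdx⟩ := Finset.exists_mem_ne (not_le.1 h1) (f x)
    obtain ⟨y, hy, rfl⟩ := Finset.mem_image.1 hd
    exact h _ ⟨x, hx, rfl⟩ ⟨y, hy, hdx⟩
  have h3 : ∑ c ∈ S.image f, (crossing M a b (· ∈ {x | f x = c})).card ≤
      ∑ c ∈ S.image f, (((crossing M a b f).filter fun e => f (a e) = c).card +
        ((crossing M a b f).filter fun e => f (b e) = c).card) := by
    refine Finset.sum_le_sum fun c _ =>
      (Finset.card_le_card fun e he => ?_).trans (Finset.card_union_le _ _)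
    simp only [crossing, Finset.mem_filter, Finset.mem_union, Set.mem_ofPred_eq, ne_eq,
      eq_iff_iff] at he ⊢
    grind
  have hmem : ∀ e ∈ crossing M a b f, f (a e) ∈ S.image f ∧ f (b e) ∈ S.image f := fun e he =>
    have := hS e (Finset.mem_filter.1 he).1
    ⟨Finset.mem_image_of_mem f this.1, Finset.mem_image_of_mem f this.2⟩
  rw [Finset.sum_add_distrib, ← Finset.card_eq_sum_card_fiberwise fun e he => (hmem e he).1,
    ← Finset.card_eq_sum_card_fiberwise fun e he => (hmem e he).2] at h3
  omega

end MaximumColoring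

/-! ### From edge-connectivity to cuts, and from connectors to trees. -/

namespace SimpleGraph

variable {V : Type*}

/-- The easy half of Menger's theorem: a cut has at least as many edges as the
edge-connectivity. -/
theorem le_card_cut [DecidableEq (Sym2 V)] (G : SimpleGraph V) {k : ℕ}
    (hk : (k + 1 : ℕ) ≤ G.edgeConnectivity) {X : Set V} {D : Finset (Sym2 V)}
    (hD : ∀ x ∈ X, ∀ y ∉ X, G.Adj x y → s(x, y) ∈ D) {u v : V} (hu : u ∈ X) (hv : v ∉ X) :
    k + 1 ≤ D.card := by
  have huv : u ≠ v := fun h => hv (h ▸ hu)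
  have h1 : ((k : ℕ) : ℕ∞) < G.maxEdgeDisjointPaths u v := by
    refine lt_of_lt_of_le ?_ (hk.trans ((iInf_le _ u).trans ((iInf_le _ v).trans (iInf_le _ huv))))
    exact_mod_cast Nat.lt_succ_self k
  unfold maxEdgeDisjointPaths at h1
  simp only [lt_iSup_iff] at h1
  obtain ⟨P, hP, hkP⟩ := h1
  -- Every path leaves `X` through an edge of `D`, and edge-disjoint paths use different ones.
  have hex : ∀ p : G.Path u v, ∃ e ∈ p.1.edges, e ∈ D := by
    intro p
    obtain ⟨d, hd, hd1, hd2⟩ := p.1.exists_boundary_dart X hu hv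
    exact ⟨d.edge, List.mem_map_of_mem hd, hD _ hd1 _ hd2 d.adj⟩
  choose φ hφ hφD using hex
  have hinj : Set.InjOn φ P := by
    intro p hp q hq hpq
    by_contra hne
    exact hP hp hq hne (hφ p) (hpq ▸ hφ q)
  have h2 : P.encard ≤ (D : Set (Sym2 V)).encard := by
    rw [← hinj.encard_image]
    refine Set.encard_le_encard ?_
    rintro _ ⟨p, -, rfl⟩
    exact hφD p
  rw [Set.encard_coe_eq_coe_finsetCard] at h2
  have h3 := lt_of_lt_of_le hkP h2
  exact_mod_cast h3

/-- The set of vertices reachable from `x` is split by no edge of `F`, so it is a valid test set for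
`Connects`. -/
theorem connected_fromEdgeSet_of_connects [Fintype V] [Nonempty V] {F : Finset (Sym2 V)}
    {a b : Sym2 V → V} (hab : ∀ e, s(a e, b e) = e) (h : Connects Finset.univ F a b) :
    (fromEdgeSet (F : Set (Sym2 V))).Connected := by
  refine ⟨fun x y => ?_⟩
  refine h {z | (fromEdgeSet (F : Set (Sym2 V))).Reachable x z} (fun e he => ?_) x
    (Finset.mem_univ _) y (Finset.mem_univ _) (Reachable.refl x)
  by_cases hne : a e = b e
  · rw [hne]
  · have hadj : (fromEdgeSet (F : Set (Sym2 V))).Adj (a e) (b e) := by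
      rw [fromEdgeSet_adj, hab]
      exact ⟨he, hne⟩
    exact ⟨fun h' => h'.trans hadj.reachable, fun h' => h'.trans hadj.symm.reachable⟩

/-- If any fraction of at least `k / (k + 1)` of a cut of size at least `m + 1` consists of at
least four edges, then an `(m + 1)`-edge-connected graph has a spanning `(k + 1)`-partite
subgraph that is a 2T-graph. -/
theorem exists_colorable_isTwoTGraph [Finite V] [Nonempty V] (G : SimpleGraph V) {k m : ℕ}
    (hm : ((m + 1 : ℕ) : ℕ∞) ≤ G.edgeConnectivity)
    (hkm : ∀ d d', m + 1 ≤ d → k * d ≤ (k + 1) * d' → 4 ≤ d') :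
    ∃ H : SimpleGraph V, H ≤ G ∧ H.Colorable (k + 1) ∧ H.IsTwoTGraph := by
  classical
  have := Fintype.ofFinite V
  obtain ⟨a, b, hab⟩ : ∃ a b : Sym2 V → V, ∀ e, s(a e, b e) = e :=
    ⟨fun e => (Quot.out e).1, fun e => (Quot.out e).2, fun e => Quot.out_eq e⟩
  obtain ⟨c, hc⟩ := exists_coloring_card_crossing_le G.edgeFinset a b k
  have hpart : PartitionCondition Finset.univ (crossing G.edgeFinset a b c) a b := by
    refine partitionCondition_of_cuts (by simp) ?_
    rintro X _ ⟨u, -, hu⟩ ⟨v, -, hv⟩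
    refine hkm _ _ (G.le_card_cut hm (X := X) ?_ hu hv) (hc X)
    intro x hx y hy hxy
    simp only [crossing, Finset.mem_filter, mem_edgeFinset, mem_edgeSet]
    refine ⟨hxy, ?_⟩
    have := hab s(x, y)
    rw [Sym2.eq_iff] at this
    rcases this with ⟨h1, h2⟩ | ⟨h1, h2⟩ <;> simp [h1, h2, hx, hy]
  obtain ⟨F₁, F₂, h₁, h₂, hd, hc₁, hc₂⟩ := hpart.hasTwoConnectors (by simp)
  obtain ⟨T₁, hle₁, hT₁⟩ := (connected_fromEdgeSet_of_connects hab hc₁).exists_isTree_le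
  obtain ⟨T₂, hle₂, hT₂⟩ := (connected_fromEdgeSet_of_connects hab hc₂).exists_isTree_le
  have hmem : ∀ x y, (T₁ ⊔ T₂).Adj x y → s(x, y) ∈ crossing G.edgeFinset a b c := by
    rintro x y (h | h)
    · exact h₁ ((fromEdgeSet_adj _).1 (hle₁ h)).1
    · exact h₂ ((fromEdgeSet_adj _).1 (hle₂ h)).1
  refine ⟨T₁ ⊔ T₂, fun x y h => ?_, ?_, T₁, T₂, hT₁, hT₂, ?_, (edgeSet_sup _ _).symm⟩
  · exact mem_edgeFinset.1 (Finset.mem_filter.1 (hmem x y h)).1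
  · have hcol : ∀ {x y}, (T₁ ⊔ T₂).Adj x y → c x ≠ c y := by
      intro x y h
      have h1 := (Finset.mem_filter.1 (hmem x y h)).2
      have h2 := hab s(x, y)
      rw [Sym2.eq_iff] at h2
      rcases h2 with ⟨h3, h4⟩ | ⟨h3, h4⟩ <;> rw [h3, h4] at h1
      exacts [h1, h1.symm]
    simpa [ZMod.card] using (Coloring.mk c hcol).colorable
  · rw [Set.disjoint_left]
    intro e he₁ he₂
    have g₁ := edgeSet_mono hle₁ he₁
    have g₂ := edgeSet_mono hle₂ he₂
    rw [edgeSet_fromEdgeSet] at g₁ g₂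
    exact Finset.disjoint_left.1 hd g₁.1 g₂.1

end SimpleGraph

theorem corollary1p5 {V : Type*} [Finite V] [Nonempty V] (G : SimpleGraph V) :
    (5 ≤ G.edgeConnectivity →
      ∃ H : SimpleGraph V, H ≤ G ∧ H.Colorable 3 ∧ H.IsTwoTGraph) ∧
    (7 ≤ G.edgeConnectivity →
      ∃ H : SimpleGraph V, H ≤ G ∧ H.IsBipartite ∧ H.IsTwoTGraph) := by
  refine ⟨fun h => ?_, fun h => ?_⟩
  -- Here `10 ≤ 3 * d'` forces `4 ≤ d'`; in the bipartite case `7 ≤ 2 * d'` does.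
  · exact G.exists_colorable_isTwoTGraph (k := 2) (m := 4) (by exact_mod_cast h)
      fun d d' _ _ => by omega
  · exact G.exists_colorable_isTwoTGraph (k := 1) (m := 6) (by exact_mod_cast h)
      fun d d' _ _ => by omega
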